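/- Let $S=K[x_1,\dots,x_n]$ be the standard graded polynomial ring over a field $K$ and let $I\subseteq S$ be a monomial ideal. For $k\ge 0$ let $I^{(k)}=\bigcap_{P\in\mathrm{Ass}(S/I)}(I^kS_P\cap S)$ be the $k$-th symbolic power of $I$, and let $\mathcal R_s(I)=\bigoplus_{k\ge0}I^{(k)}t^k\subseteq S[t]$ be the symbolic Rees algebra. Let $x_1,\dots,x_n,u_1t^{q_1},\dots,u_mt^{q_m}$, with $u_j\in S$ monomials and $q_j>0$, be the minimal monomial generators of the $K$-algebra $\mathcal R_s(I)$. Let $T=K[x_1,\dots,x_n,y_1,\dots,y_m]$ be bigraded by $\mathrm{bideg}(x_i)=(1,0)$ and $\mathrm{bideg}(y_j)=(\deg u_j,q_j)$, and regard $\mathcal R_s(I)$ as a bigraded $T$-module through the $K$-algebra homomorphism $T\to\mathcal R_s(I)$, $x_i\mapsto x_i$, $y_j\mapsto u_jt^{q_j}$. Let $$0\to F_p\to\cdots\to F_1\to F_0\to\mathcal R_s(I)\to0,\qquad F_i=\bigoplus_jT(-a_{ij},-b_{ij}),$$ be the minimal bigraded free $T$-resolution of $\mathcal R_s(I)$, and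 put $\mathrm{reg}_x\,\mathcal R_s(I)=\max_{i,j}\{a_{ij}-i\}$. For $k\ge1$ put $$d(I,k)=\max\Big\{\sum_{s=1}^m c_s\deg(u_s)\ :\ (c_1,\dots,c_m)\in\mathbb Z_{\ge0}^m,\ \sum_{s=1}^m c_sq_s\le k\Big\}.$$ Then for all $k\ge1$ $$\mathrm{reg}\,I^{(k)}\ \le\ \mathrm{reg}_x\,\mathcal R_s(I)+d(I,k),$$ where the Castelnuovo–Mumford regularity $\mathrm{reg}\,M$ of a finitely generated graded $S$-module $M$ is $\max_{i,j}\{e_{ij}-i\}$ for the minimal graded free resolution of $M$ with $i$-th module $\bigoplus_jS(-e_{ij})$, and $\mathrm{reg}\,0=-\infty$. -/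

import Mathlib

noncomputable section

open MvPolynomial

/-! ### Symbolic powers -/

/-- The `k`-th symbolic power `I^(k) = ⋂_{P ∈ Ass(R/I)} (I^k R_P ∩ R)`. The intersection over the
empty family (which occurs only for `I = R`) is `R`. -/
def symbolicPower {R : Type*} [CommRing R] (I : Ideal R) (k : ℕ) : Ideal R :=
  ⨅ P : associatedPrimes R (R ⧸ I),
    have : P.1.IsPrime := P.2.isPrime
    ((I ^ k).map (algebraMap R (Localization.AtPrime P.1))).comap
      (algebraMap R (Localization.AtPrime P.1))

theorem mem_symbolicPower {R : Type*} [CommRing R] {I : Ideal R} {k : ℕ} {f : R} :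
    f ∈ symbolicPower I k ↔ ∀ P : associatedPrimes R (R ⧸ I),
      have : P.1.IsPrime := P.2.isPrime
      algebraMap R (Localization.AtPrime P.1) f ∈
        (I ^ k).map (algebraMap R (Localization.AtPrime P.1)) := by
  simp [symbolicPower, Ideal.mem_comap]

theorem symbolicPower_zero {R : Type*} [CommRing R] (I : Ideal R) :
    symbolicPower I 0 = ⊤ := by
  rw [eq_top_iff]
  intro f _
  rw [mem_symbolicPower]
  intro P
  simp [Ideal.map_top]

theorem mul_mem_symbolicPower {R : Type*} [CommRing R] {I : Ideal R} {a b : ℕ} {f g : R}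
    (hf : f ∈ symbolicPower I a) (hg : g ∈ symbolicPower I b) :
    f * g ∈ symbolicPower I (a + b) := by
  rw [mem_symbolicPower] at *
  intro P
  have h1 := hf P
  have h2 := hg P
  dsimp only at h1 h2 ⊢
  rw [map_mul, pow_add, Ideal.map_mul]
  exact Ideal.mul_mem_mul h1 h2

/-! ### Monomial ideals and the symbolic Rees algebra -/

/-- A monomial ideal is an ideal generated by monomials `x^a`. -/
def IsMonomialIdeal {K : Type*} [Field K] {n : ℕ} (I : Ideal (MvPolynomial (Fin n) K)) : Prop :=
  ∃ A : Set (Fin n →₀ ℕ), I = Ideal.span ((fun a => monomial a (1 : K)) '' A)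

/-- The symbolic Rees algebra `⨁_{k ≥ 0} I^(k) t^k`, as a `K`-subalgebra of `S[t]`. -/
def symbolicReesAlgebra {K : Type*} [Field K] {n : ℕ} (I : Ideal (MvPolynomial (Fin n) K)) :
    Subalgebra K (Polynomial (MvPolynomial (Fin n) K)) where
  carrier := {f | ∀ k, f.coeff k ∈ symbolicPower I k}
  mul_mem' := by
    intro f g hf hg k
    rw [Polynomial.coeff_mul]
    refine Ideal.sum_mem _ fun p hp => ?_
    rw [← Finset.HasAntidiagonal.mem_antidiagonal.mp hp]
    exact mul_mem_symbolicPower (hf _) (hg _)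
  add_mem' := by
    intro f g hf hg k
    rw [Polynomial.coeff_add]
    exact Ideal.add_mem _ (hf k) (hg k)
  algebraMap_mem' := by
    intro r k
    rw [Polynomial.algebraMap_apply, Polynomial.coeff_C]
    split_ifs with h
    · subst h
      rw [symbolicPower_zero]
      trivial
    · exact Ideal.zero_mem _

/-- The monomials `u t^q` of the symbolic Rees algebra of `I`, where `u = x^a`: the pairs `(a, q)`
with `x^a ∈ I^(q)`. -/
def SymbolicMonomial {K : Type*} [Field K] {n : ℕ} (I : Ideal (MvPolynomial (Fin n) K)) : Type :=
  {p : (Fin n →₀ ℕ) × ℕ // monomial p.1 (1 : K) ∈ symbolicPower I p.2}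

namespace SymbolicMonomial

variable {K : Type*} [Field K] {n : ℕ} {I : Ideal (MvPolynomial (Fin n) K)}

/-- The degree of `u` in the monomial `u t^q`. -/
def xDeg (g : SymbolicMonomial I) : ℕ := g.1.1.degree

/-- The exponent `q` in the monomial `u t^q`. -/
def tDeg (g : SymbolicMonomial I) : ℕ := g.1.2

/-- The element `u t^q` of the symbolic Rees algebra. -/
def toRees (g : SymbolicMonomial I) : symbolicReesAlgebra I :=
  ⟨Polynomial.monomial g.1.2 (monomial g.1.1 (1 : K)), by
    intro k
    rw [Polynomial.coeff_monomial]
    split_ifs with h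
    · exact h ▸ g.2
    · exact Ideal.zero_mem _⟩

end SymbolicMonomial

/-- The variable `x_i`, as an element of the symbolic Rees algebra. -/
def xRees {K : Type*} [Field K] {n : ℕ} (I : Ideal (MvPolynomial (Fin n) K)) (i : Fin n) :
    symbolicReesAlgebra I :=
  ⟨Polynomial.C (X i), by
    intro k
    rw [Polynomial.coeff_C]
    split_ifs with h
    · subst h
      rw [symbolicPower_zero]
      trivial
    · exact Ideal.zero_mem _⟩

/-- The variables `x_1, …, x_n` together with the monomials `u t^q` of `Γ` generate the symbolic
Rees algebra of `I` as a `K`-algebra. -/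
def GeneratesRees {K : Type*} [Field K] {n : ℕ} {I : Ideal (MvPolynomial (Fin n) K)}
    (Γ : Set (SymbolicMonomial I)) : Prop :=
  Algebra.adjoin K (Set.range (xRees I) ∪ SymbolicMonomial.toRees '' Γ) = ⊤

/-- `Γ` is the set of those minimal monomial generators `u t^q` of the symbolic Rees algebra of `I`
that have `q > 0`, so that `x_1, …, x_n` and the members of `Γ` are the minimal monomial
generators. No finiteness is assumed. -/
structure IsMinimalGenerators {K : Type*} [Field K] {n : ℕ} {I : Ideal (MvPolynomial (Fin n) K)}
    (Γ : Set (SymbolicMonomial I)) : Prop where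
  pos : ∀ g ∈ Γ, 0 < g.tDeg
  generates : GeneratesRees Γ
  minimal : ∀ Γ' ⊆ Γ, GeneratesRees Γ' → Γ' = Γ

/-- The values `∑ c_s deg(u_s)`, where `c` runs over the (finitely supported) families of natural
numbers indexed by `Γ` with `∑ c_s q_s ≤ k`. -/
def dValues {K : Type*} [Field K] {n : ℕ} {I : Ideal (MvPolynomial (Fin n) K)}
    (Γ : Set (SymbolicMonomial I)) (k : ℕ) : Set ℕ :=
  {z | ∃ c : Γ →₀ ℕ, (c.sum fun g m => m * g.1.tDeg) ≤ k ∧ z = c.sum fun g m => m * g.1.xDeg}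

/-- `d(I,k)`, the maximum of the values `∑ c_s deg(u_s)` under the constraint `∑ c_s q_s ≤ k`. -/
def dMax {K : Type*} [Field K] {n : ℕ} {I : Ideal (MvPolynomial (Fin n) K)}
    (Γ : Set (SymbolicMonomial I)) (k : ℕ) : ℕ :=
  sSup (dValues Γ k)

/-! ### The symbolic Rees algebra as a bigraded module over `T = K[x, y]` -/

/-- The homomorphism `φ : T = K[x_1, …, x_n, y_g (g ∈ Γ)] → R_s(I)` with `φ(x_i) = x_i` and
`φ(y_g) = u t^q` for `g = u t^q`. -/
def reesMap {K : Type*} [Field K] {n : ℕ} {I : Ideal (MvPolynomial (Fin n) K)}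
    (Γ : Set (SymbolicMonomial I)) :
    MvPolynomial (Fin n ⊕ Γ) K →ₐ[K] symbolicReesAlgebra I :=
  aeval (Sum.elim (xRees I) fun g => g.1.toRees)

/-- The bidegrees of the variables of `T`: `bideg(x_i) = (1, 0)` and `bideg(y_g) = (deg u, q)` for
`g = u t^q`. -/
def reesBideg {K : Type*} [Field K] {n : ℕ} {I : Ideal (MvPolynomial (Fin n) K)}
    (Γ : Set (SymbolicMonomial I)) : Fin n ⊕ Γ → ℤ × ℤ :=
  Sum.elim (fun _ => (1, 0)) fun g => ((g.1.xDeg : ℤ), (g.1.tDeg : ℤ))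

/-- The symbolic Rees algebra of `I`, regarded as a `T`-module through `φ`. -/
def ReesModule {K : Type*} [Field K] {n : ℕ} {I : Ideal (MvPolynomial (Fin n) K)}
    (_Γ : Set (SymbolicMonomial I)) : Type _ :=
  symbolicReesAlgebra I

instance {K : Type*} [Field K] {n : ℕ} {I : Ideal (MvPolynomial (Fin n) K)}
    (Γ : Set (SymbolicMonomial I)) : AddCommGroup (ReesModule Γ) :=
  inferInstanceAs (AddCommGroup (symbolicReesAlgebra I))

instance {K : Type*} [Field K] {n : ℕ} {I : Ideal (MvPolynomial (Fin n) K)}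
    (Γ : Set (SymbolicMonomial I)) : Module (MvPolynomial (Fin n ⊕ Γ) K) (ReesModule Γ) :=
  Module.compHom (symbolicReesAlgebra I) (reesMap Γ).toRingHom

/-- The bigrading of the symbolic Rees algebra: the component of bidegree `(a, b)` consists of the
`K`-linear combinations of the monomials `x^e t^k` with `(deg x^e, k) = (a, b)` in it. -/
def reesBigrading {K : Type*} [Field K] {n : ℕ} {I : Ideal (MvPolynomial (Fin n) K)}
    (Γ : Set (SymbolicMonomial I)) (ab : ℤ × ℤ) : AddSubgroup (ReesModule Γ) where
  carrier := {f | ∀ (k : ℕ) (e : Fin n →₀ ℕ),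
    ((show symbolicReesAlgebra I from f).1.coeff k).coeff e ≠ 0 → ((e.degree : ℤ), (k : ℤ)) = ab}
  zero_mem' := by
    intro k e h
    exact absurd rfl h
  add_mem' := by
    intro f g hf hg k e h
    by_contra hne
    have h1 := not_not.mp (mt (hf k e) hne)
    have h2 := not_not.mp (mt (hg k e) hne)
    apply h
    change (((show symbolicReesAlgebra I from f).1
      + (show symbolicReesAlgebra I from g).1).coeff k).coeff e = 0
    rw [Polynomial.coeff_add, MvPolynomial.coeff_add, h1, h2, add_zero]
  neg_mem' := by
    intro f hf k e h
    apply hf k e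
    intro h1
    apply h
    change ((-(show symbolicReesAlgebra I from f).1).coeff k).coeff e = 0
    rw [Polynomial.coeff_neg, MvPolynomial.coeff_neg, h1, neg_zero]

/-- The standard grading of an ideal of `S = K[x_1, …, x_n]`: the component of degree `a` consists
of the homogeneous polynomials of degree `a` in the ideal. -/
def idealGrading {K : Type*} [Field K] {n : ℕ} (J : Ideal (MvPolynomial (Fin n) K)) (a : ℤ) :
    AddSubgroup J where
  carrier := {f | ∀ e : Fin n →₀ ℕ, f.1.coeff e ≠ 0 → (e.degree : ℤ) = a}
  zero_mem' := by
    intro e h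
    exact absurd rfl h
  add_mem' := by
    intro f g hf hg e h
    by_contra hne
    have h1 := not_not.mp (mt (hf e) hne)
    have h2 := not_not.mp (mt (hg e) hne)
    apply h
    change (f.1 + g.1).coeff e = 0
    rw [MvPolynomial.coeff_add, h1, h2, add_zero]
  neg_mem' := by
    intro f hf e h
    apply hf e
    intro h1
    apply h
    change (-f.1).coeff e = 0
    rw [MvPolynomial.coeff_neg, h1, neg_zero]

/-! ### Graded free resolutions and regularity -/

/-- A finite graded free resolution `0 → F_p → ⋯ → F_1 → F_0 → M → 0` of a module `M` with graded
components `ℳ`, over the polynomial ring in the variables `σ`, graded by `deg(x_s) = w s` in the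
group `G`. Here `F_i = ⨁_j R(-shift i j)`, so that the `j`-th basis vector of `F_i` has degree
`shift i j`, and all maps are homogeneous of degree zero. -/
structure GradedFreeResolution {σ : Type*} (K : Type*) {G : Type*} [Field K] [AddCommGroup G]
    (w : σ → G)
    {M : Type*} [AddCommGroup M] [Module (MvPolynomial σ K) M] (ℳ : G → AddSubgroup M) where
  /-- the length `p` -/
  length : ℕ
  /-- the rank of `F_i` -/
  rank : ℕ → ℕ
  rank_eq_zero : ∀ i, length < i → rank i = 0
  /-- the degrees of the basis vectors of `F_i` -/
  shift : ∀ i, Fin (rank i) → G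
  /-- the differentials `F_{i+1} → F_i` -/
  d : ∀ i, (Fin (rank (i + 1)) → MvPolynomial σ K) →ₗ[MvPolynomial σ K]
    (Fin (rank i) → MvPolynomial σ K)
  /-- the augmentation `F_0 → M` -/
  aug : (Fin (rank 0) → MvPolynomial σ K) →ₗ[MvPolynomial σ K] M
  aug_surjective : Function.Surjective aug
  exact_zero : Function.Exact (d 0) aug
  exact_succ : ∀ i, Function.Exact (d (i + 1)) (d i)
  d_homogeneous : ∀ (i : ℕ) (l : Fin (rank (i + 1))) (j : Fin (rank i)),
    IsWeightedHomogeneous w (d i (Pi.single l 1) j) (shift (i + 1) l - shift i j)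
  aug_homogeneous : ∀ j : Fin (rank 0), aug (Pi.single j 1) ∈ ℳ (shift 0 j)

namespace GradedFreeResolution

variable {σ K G : Type*} [Field K] [AddCommGroup G] {w : σ → G}
  {M : Type*} [AddCommGroup M] [Module (MvPolynomial σ K) M] {ℳ : G → AddSubgroup M}

/-- The resolution is minimal: the entries of all differentials lie in the ideal generated by the
variables. -/
def IsMinimal (F : GradedFreeResolution K w ℳ) : Prop :=
  ∀ (i : ℕ) (l : Fin (F.rank (i + 1))) (j : Fin (F.rank i)),
    constantCoeff (F.d i (Pi.single l 1) j) = 0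

/-- `max_{i,j} {δ(shift i j) - i}`, where `δ` reads off an integer from a degree. It is `⊥ = -∞` if
and only if the resolution is zero, that is, `M = 0`. For `δ = id` and a minimal resolution it is
the Castelnuovo-Mumford regularity, for `δ` the first component of a bidegree it is the
`x`-regularity. -/
def reg (F : GradedFreeResolution K w ℳ) (δ : G → ℤ) : WithBot ℤ :=
  (Finset.range (F.length + 1)).sup fun i =>
    Finset.univ.sup fun j : Fin (F.rank i) => ((δ (F.shift i j) - (i : ℤ) : ℤ) : WithBot ℤ)

end GradedFreeResolution

end

noncomputable section

open MvPolynomial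

/-! ### Comparison of exact complexes -/

/-! Write S = K[x], T = K[x, y]. As an S-module, R_s(I) has I^(k) as a direct summand, via `incl`
and `proj`. Since T is S-free on the monomials y^c, the given T-resolution F restricts to an S-free
resolution of R_s(I), of possibly infinite rank.

Let H be a minimal resolution of I^(k). The inclusion lifts to a chain map φ : H → F carrying a
basis vector of degree e to a bihomogeneous vector of bidegree (e, k)
(`exists_homogeneous_chainMap`). The projection lifts to some ψ : F → H, and ψφ is homotopic to the
identity. As H is minimal, the homotopy terms vanish modulo (x), so φ is injective modulo (x)
(`mem_smul_top_of_chainMap_mem`). Hence the image of a basis vector of H_i has an entry containing a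
monomial y^c free of x. Comparing bidegrees (`exists_shift_eq`), (e, k) = (a_ij, b_ij) + ∑ c_s (deg
u_s, q_s).

Minimality of F gives b_ij ≥ 0, so ∑ c_s q_s ≤ k and e - i ≤ (a_ij - i) + d(I, k). That d(I, k) is a
genuine maximum, even for infinite Γ, follows from Dickson's lemma: only finitely many generators
have q ≤ k. -/

theorem exists_dependent_seq {X : ℕ → Type*} (good : ∀ i, X i → Prop)
    (R : ∀ i, X i → X (i + 1) → Prop) (base : ∃ x, good 0 x)
    (step : ∀ i x, good i x → ∃ y, good (i + 1) y ∧ R i x y) :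
    ∃ f : ∀ i, X i, (∀ i, good i (f i)) ∧ ∀ i, R i (f i) (f (i + 1)) := by
  choose next hgood hR using step
  obtain ⟨x, hx⟩ := base
  let f : ∀ i, {x : X i // good i x} := fun i =>
    Nat.rec ⟨x, hx⟩ (fun i y => ⟨next i y.1 y.2, hgood i y.1 y.2⟩) i
  exact ⟨fun i => (f i).1, fun i => (f i).2, fun i => hR i (f i).1 (f i).2⟩

/-- The image of `h` lies in ker `g` = range `f`, and a projective source lifts along the surjection
`A` → range `f`. -/
theorem Function.Exact.exists_comp_eq {S P A B C : Type*} [CommRing S] [AddCommGroup P]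
    [AddCommGroup A] [AddCommGroup B] [AddCommGroup C] [Module S P] [Module S A] [Module S B]
    [Module S C] [Module.Projective S P] {f : A →ₗ[S] B} {g : B →ₗ[S] C}
    (hfg : Function.Exact f g) (h : P →ₗ[S] B) (hh : g ∘ₗ h = 0) :
    ∃ l : P →ₗ[S] A, f ∘ₗ l = h := by
  have hmem : ∀ p, h p ∈ LinearMap.range f := fun p => by
    obtain ⟨a, ha⟩ := (hfg (h p)).1 (LinearMap.congr_fun hh p)
    exact ⟨a, ha⟩
  obtain ⟨l, hl⟩ := Module.projective_lifting_property f.rangeRestrict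
    (h.codRestrict (LinearMap.range f) hmem) f.surjective_rangeRestrict
  refine ⟨l, LinearMap.ext fun p => ?_⟩
  exact congrArg Subtype.val (LinearMap.congr_fun hl p)

section Comparison

variable {S : Type*} [CommRing S] {A B : ℕ → Type*}
  [∀ i, AddCommGroup (A i)] [∀ i, Module S (A i)] [∀ i, AddCommGroup (B i)] [∀ i, Module S (B i)]
  {M N : Type*} [AddCommGroup M] [Module S M] [AddCommGroup N] [Module S N]
  {dA : ∀ i, A (i + 1) →ₗ[S] A i} {dB : ∀ i, B (i + 1) →ₗ[S] B i}
  {augA : A 0 →ₗ[S] M} {augB : B 0 →ₗ[S] N}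

/-- A linear map lifts to a chain map from a complex of projectives to a resolution. -/
theorem exists_chainMap_lift [∀ i, Module.Projective S (B i)]
    (hsurj : Function.Surjective augA) (hA0 : Function.Exact (dA 0) augA)
    (hA : ∀ i, Function.Exact (dA (i + 1)) (dA i))
    (hB0 : augB ∘ₗ dB 0 = 0) (hB : ∀ i, dB i ∘ₗ dB (i + 1) = 0) (π : N →ₗ[S] M) :
    ∃ ψ : ∀ i, B i →ₗ[S] A i, augA ∘ₗ ψ 0 = π ∘ₗ augB ∧
      ∀ i, dA i ∘ₗ ψ (i + 1) = ψ i ∘ₗ dB i := by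
  obtain ⟨ψ₀, h₀⟩ := Module.projective_lifting_property augA (π ∘ₗ augB) hsurj
  have hψ₀ : ∃ l, dA 0 ∘ₗ l = ψ₀ ∘ₗ dB 0 := by
    apply hA0.exists_comp_eq
    rw [← LinearMap.comp_assoc, h₀, LinearMap.comp_assoc, hB0, LinearMap.comp_zero]
  -- The invariant carries solvability of the next lifting problem. Its second clause pins the term
  -- in degree 0 and is vacuous in positive degrees.
  obtain ⟨ψ, hψ, hR⟩ := exists_dependent_seq (X := fun i => B i →ₗ[S] A i)
    (fun i f => (∃ l, dA i ∘ₗ l = f ∘ₗ dB i) ∧ ((h : i = 0) → f = h ▸ ψ₀))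
    (fun i f g => dA i ∘ₗ g = f ∘ₗ dB i) ⟨ψ₀, hψ₀, fun _ => rfl⟩ (by
      rintro i f ⟨⟨l, hl⟩, -⟩
      refine ⟨l, ⟨?_, fun h => by omega⟩, hl⟩
      apply (hA i).exists_comp_eq
      rw [← LinearMap.comp_assoc, hl, LinearMap.comp_assoc, hB, LinearMap.comp_zero])
  refine ⟨ψ, ?_, hR⟩
  rw [(hψ 0).2 rfl, h₀]

/-- A chain endomorphism of a projective resolution over zero is null-homotopic. -/
theorem exists_nullhomotopy [∀ i, Module.Projective S (A i)]
    (hA0 : Function.Exact (dA 0) augA) (hA : ∀ i, Function.Exact (dA (i + 1)) (dA i))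
    (ρ : ∀ i, A i →ₗ[S] A i) (hρ0 : augA ∘ₗ ρ 0 = 0)
    (hρ : ∀ i, dA i ∘ₗ ρ (i + 1) = ρ i ∘ₗ dA i) :
    ∃ s : ∀ i, A i →ₗ[S] A (i + 1), ρ 0 = dA 0 ∘ₗ s 0 ∧
      ∀ i, ρ (i + 1) = dA (i + 1) ∘ₗ s (i + 1) + s i ∘ₗ dA i := by
  obtain ⟨s₀, h₀⟩ := hA0.exists_comp_eq (ρ 0) hρ0
  -- The homotopy identity in degree i is kept only after composing with d_i, where its term through
  -- s_{i-1} dies. This already forces ρ_{i+1} - s_i d_i into ker d_i.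
  obtain ⟨s, hs, hR⟩ := exists_dependent_seq (X := fun i => A i →ₗ[S] A (i + 1))
    (fun i f => (dA i ∘ₗ f ∘ₗ dA i = ρ i ∘ₗ dA i) ∧ ((h : i = 0) → f = h ▸ s₀))
    (fun i f g => ρ (i + 1) = dA (i + 1) ∘ₗ g + f ∘ₗ dA i)
    ⟨s₀, by rw [← LinearMap.comp_assoc, h₀], fun _ => rfl⟩ (by
      rintro i f ⟨hf, -⟩
      obtain ⟨l, hl⟩ := (hA i).exists_comp_eq (ρ (i + 1) - f ∘ₗ dA i)
        (by rw [LinearMap.comp_sub, hρ, hf, sub_self])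
      refine ⟨l, ⟨?_, fun h => by omega⟩, by rw [hl, sub_add_cancel]⟩
      rw [← LinearMap.comp_assoc, hl, LinearMap.sub_comp, LinearMap.comp_assoc (dA (i + 1)),
        (hA i).linearMap_comp_eq_zero, LinearMap.comp_zero, sub_zero])
  exact ⟨s, by rw [(hs 0).2 rfl, h₀], hR⟩

/-- A minimal projective resolution of a direct summand stays a direct summand modulo the maximal
ideal: a chain map over a split injection into a complex of projectives is injective modulo `m`. -/
theorem mem_smul_top_of_chainMap_mem [∀ i, Module.Projective S (A i)]
    [∀ i, Module.Projective S (B i)] {m : Ideal S}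
    (hsurj : Function.Surjective augA) (hA0 : Function.Exact (dA 0) augA)
    (hA : ∀ i, Function.Exact (dA (i + 1)) (dA i))
    (hmin : ∀ i x, dA i x ∈ m • (⊤ : Submodule S (A i)))
    (hB0 : augB ∘ₗ dB 0 = 0) (hB : ∀ i, dB i ∘ₗ dB (i + 1) = 0) (π : N →ₗ[S] M)
    (φ : ∀ i, A i →ₗ[S] B i) (hφ0 : π ∘ₗ augB ∘ₗ φ 0 = augA)
    (hφ : ∀ i, dB i ∘ₗ φ (i + 1) = φ i ∘ₗ dA i) (i : ℕ) (x : A i)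
    (hx : φ i x ∈ m • (⊤ : Submodule S (B i))) : x ∈ m • (⊤ : Submodule S (A i)) := by
  obtain ⟨ψ, hψ0, hψ⟩ := exists_chainMap_lift hsurj hA0 hA hB0 hB π
  obtain ⟨s, hs0, hs⟩ := exists_nullhomotopy hA0 hA (fun i => LinearMap.id - ψ i ∘ₗ φ i)
    (by rw [LinearMap.comp_sub, ← LinearMap.comp_assoc, hψ0, LinearMap.comp_assoc, hφ0,
      LinearMap.comp_id, sub_self])
    (fun i => by rw [LinearMap.comp_sub, ← LinearMap.comp_assoc, hψ, LinearMap.comp_assoc, hφ,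
      LinearMap.sub_comp, LinearMap.comp_id, LinearMap.id_comp, LinearMap.comp_assoc])
  -- x - ψφx is a sum of homotopy terms, which minimality puts in `m` times the module; ψφx is there
  -- because φx is.
  rw [← sub_add_cancel x (ψ i (φ i x))]
  refine Submodule.add_mem _ ?_ (Submodule.smul_top_le_comap_smul_top m (ψ i) hx)
  cases i with
  | zero =>
    have := LinearMap.congr_fun hs0 x
    simp only [LinearMap.sub_apply, LinearMap.id_apply, LinearMap.comp_apply] at this
    rw [this]
    exact hmin _ _
  | succ i =>
    have := LinearMap.congr_fun (hs i) x
    simp only [LinearMap.sub_apply, LinearMap.id_apply, LinearMap.comp_apply,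
      LinearMap.add_apply] at this
    rw [this]
    exact Submodule.add_mem _ (hmin _ _) (Submodule.smul_top_le_comap_smul_top m (s i) (hmin _ _))

end Comparison

/-! ### Monomials of the symbolic Rees algebra -/

section ReesMonomials

variable {K : Type*} [Field K] {n : ℕ} {I : Ideal (MvPolynomial (Fin n) K)}

/-- The exponent `(e, t)` of the image `x^e T^t` of a monomial of `T`. -/
def reesExponent (Γ : Set (SymbolicMonomial I)) :
    (Fin n ⊕ Γ →₀ ℕ) →+ (Fin n →₀ ℕ) × ℕ :=
  Finsupp.weight (Sum.elim (fun i => (Finsupp.single i 1, 0)) fun g : Γ => g.1.1)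

variable {Γ : Set (SymbolicMonomial I)}

theorem reesExponent_single_inl (i : Fin n) (m : ℕ) :
    reesExponent Γ (Finsupp.single (Sum.inl i) m) = (Finsupp.single i m, 0) := by
  simp [reesExponent, Finsupp.weight_apply, Finsupp.sum_single_index]

theorem reesExponent_single_inr (g : Γ) (m : ℕ) :
    reesExponent Γ (Finsupp.single (Sum.inr g) m) = m • g.1.1 := by
  simp [reesExponent, Finsupp.weight_apply]

theorem SymbolicMonomial.le_reesExponent {u : Fin n ⊕ Γ →₀ ℕ} {g : Γ} (h : u (Sum.inr g) ≠ 0) :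
    g.1.1 ≤ reesExponent Γ u :=
  Finsupp.le_weight_of_ne_zero (w := Sum.elim (fun i => (Finsupp.single i 1, 0)) fun g => g.1.1)
    (fun _ => bot_le) h

theorem weight_reesBideg (u : Fin n ⊕ Γ →₀ ℕ) :
    Finsupp.weight (reesBideg Γ) u =
      (((reesExponent Γ u).1.degree : ℤ), ((reesExponent Γ u).2 : ℤ)) := by
  induction u using Finsupp.induction_linear with
  | zero => simp; rfl
  | add u v hu hv => simp [map_add, hu, hv]
  | single s m =>
    rcases s with i | g
    · simp [reesExponent_single_inl, Finsupp.weight_apply, Finsupp.sum_single_index, reesBideg,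
        -nsmul_eq_mul]
    · simp [reesExponent_single_inr, Finsupp.weight_apply, Finsupp.sum_single_index, reesBideg,
        SymbolicMonomial.xDeg, SymbolicMonomial.tDeg, map_nsmul, -nsmul_eq_mul]

theorem reesMap_monomial (u : Fin n ⊕ Γ →₀ ℕ) (r : K) :
    (reesMap Γ (monomial u r)).1 =
      Polynomial.monomial (reesExponent Γ u).2 (monomial (reesExponent Γ u).1 r) := by
  induction u using Finsupp.induction_linear generalizing r with
  | zero =>
    rw [map_zero, ← C_apply, ← algebraMap_eq, AlgHom.commutes]
    rfl
  | add u v hu hv =>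
    have : monomial (u + v) r = monomial u 1 * monomial v r := by rw [monomial_mul, one_mul]
    rw [this, map_mul, Subalgebra.coe_mul, hu, hv, Polynomial.monomial_mul_monomial, monomial_mul,
      one_mul, map_add]
    rfl
  | single s m =>
    rw [← C_mul_X_pow_eq_monomial, map_mul, map_pow, Subalgebra.coe_mul, Subalgebra.coe_pow,
      ← algebraMap_eq, AlgHom.commutes]
    have hr : ((algebraMap K (symbolicReesAlgebra I) r : symbolicReesAlgebra I) :
        Polynomial (MvPolynomial (Fin n) K)) = Polynomial.C (C r) := rfl
    rw [hr]
    rcases s with i | g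
    · have : (reesMap Γ (X (Sum.inl i))).1 = Polynomial.C (X i) := by simp [reesMap, xRees]
      rw [this, reesExponent_single_inl, ← Polynomial.C_pow, ← Polynomial.C_mul,
        C_mul_X_pow_eq_monomial, Polynomial.monomial_zero_left]
    · have : (reesMap Γ (X (Sum.inr g))).1 =
          Polynomial.monomial g.1.1.2 (monomial g.1.1.1 1) := by
        simp [reesMap, SymbolicMonomial.toRees]
      rw [this, reesExponent_single_inr, Polynomial.monomial_pow, Polynomial.C_mul_monomial,
        monomial_pow, C_mul_monomial, one_pow, mul_one, mul_comm]
      rfl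

theorem range_reesMap (Γ : Set (SymbolicMonomial I)) :
    (reesMap Γ).range =
      Algebra.adjoin K (Set.range (xRees I) ∪ SymbolicMonomial.toRees '' Γ) := by
  rw [reesMap, ← Algebra.adjoin_range_eq_range_aeval, Set.Sum.elim_range, Set.image_eq_range]

/-- A monomial of the symbolic Rees algebra is a product of generators. -/
theorem GeneratesRees.exists_reesExponent_eq (hΓ : GeneratesRees Γ) (g : SymbolicMonomial I) :
    ∃ u, reesExponent Γ u = g.1 := by
  have hg : g.toRees ∈ (reesMap Γ).range := by
    rw [range_reesMap, hΓ]
    trivial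
  obtain ⟨p, hp⟩ := hg
  by_contra! hne
  -- `reesMap` sends monomials to monomials, so if no monomial hits the exponent of `g`, that
  -- coefficient vanishes on the whole image.
  have key : ∀ q : MvPolynomial (Fin n ⊕ Γ) K,
      ((reesMap Γ q).1.coeff g.1.2).coeff g.1.1 = 0 := by
    intro q
    induction q using MvPolynomial.induction_on' with
    | monomial u r =>
      rw [reesMap_monomial, Polynomial.coeff_monomial]
      split_ifs with h
      · rw [coeff_monomial, if_neg]
        exact fun h' => hne u (Prod.ext h' h)
      · simp
    | add q₁ q₂ h₁ h₂ =>
      rw [map_add, Subalgebra.coe_add, Polynomial.coeff_add, coeff_add, h₁, h₂, add_zero]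
  have h := key p
  have hp' : reesMap Γ p = g.toRees := hp
  rw [hp'] at h
  simp [SymbolicMonomial.toRees] at h

theorem SymbolicMonomial.toRees_eq_reesMap {g : SymbolicMonomial I} {u : Fin n ⊕ Γ →₀ ℕ}
    (h : reesExponent Γ u = g.1) : g.toRees = reesMap Γ (monomial u 1) := by
  apply Subtype.ext
  rw [reesMap_monomial, h]
  rfl

/-! ### The maximum `d(I, k)` -/

/-- The exponent of a minimal generator `u t^q` is minimal among the exponents of `I^(q)`. -/
theorem IsMinimalGenerators.eq_of_le (hΓ : IsMinimalGenerators Γ) {g h : SymbolicMonomial I}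
    (hg : g ∈ Γ) (ht : h.tDeg = g.tDeg) (hle : h.1.1 ≤ g.1.1) : h.1.1 = g.1.1 := by
  by_contra hne
  obtain ⟨u, hu⟩ := hΓ.generates.exists_reesExponent_eq h
  -- The generator `g` cannot occur in a factorization of its proper divisor `h`. So `h`, and with
  -- it `g` (an x-monomial times `h`), is generated by the x_i and Γ \ {g}, against minimality.
  have hug : u (Sum.inr ⟨g, hg⟩) = 0 := by
    by_contra h0
    have := SymbolicMonomial.le_reesExponent h0
    rw [hu] at this
    exact hne (le_antisymm hle this.1)
  set A := Algebra.adjoin K (Set.range (xRees I) ∪ SymbolicMonomial.toRees '' (Γ \ {g})) with hA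
  have hx : ∀ i, xRees I i ∈ A := fun i => Algebra.subset_adjoin (Or.inl ⟨i, rfl⟩)
  have hy : ∀ y ∈ Γ, y ≠ g → y.toRees ∈ A := fun y hy hyg =>
    Algebra.subset_adjoin (Or.inr ⟨y, ⟨hy, hyg⟩, rfl⟩)
  have hhA : h.toRees ∈ A := by
    rw [SymbolicMonomial.toRees_eq_reesMap hu, reesMap, aeval_monomial, map_one, one_mul]
    refine Subalgebra.prod_mem _ fun s hs => ?_
    rcases s with i | y
    · exact Subalgebra.pow_mem _ (hx i) _
    · refine Subalgebra.pow_mem _ (hy y.1 y.2 ?_) _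
      rintro rfl
      exact Finsupp.mem_support_iff.1 hs hug
  have hgA : g.toRees ∈ A := by
    have hprod : g.toRees = (g.1.1 - h.1.1).prod (fun i k => xRees I i ^ k) * h.toRees := by
      apply Subtype.ext
      have hcoe : (((g.1.1 - h.1.1).prod fun i k => xRees I i ^ k : symbolicReesAlgebra I) :
          Polynomial (MvPolynomial (Fin n) K)) =
            Polynomial.C (monomial (g.1.1 - h.1.1) (1 : K)) := by
        rw [monomial_eq, C_1, one_mul, Finsupp.prod, Finsupp.prod, map_prod]
        simp [xRees]
      rw [Subalgebra.coe_mul, hcoe]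
      change Polynomial.monomial g.tDeg _ = _ * Polynomial.monomial h.tDeg _
      rw [Polynomial.C_mul_monomial, monomial_mul, one_mul, tsub_add_cancel_of_le hle, ht]
    rw [hprod]
    exact Subalgebra.mul_mem _
      (Subalgebra.prod_mem _ fun i _ => Subalgebra.pow_mem _ (hx i) _) hhA
  have hgen : GeneratesRees (Γ \ {g}) := by
    rw [GeneratesRees, ← hA, eq_top_iff, ← hΓ.generates, Algebra.adjoin_le_iff]
    rintro - (⟨i, rfl⟩ | ⟨y, hyΓ, rfl⟩)
    · exact hx i
    · by_cases hyg : y = g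
      · exact hyg ▸ hgA
      · exact hy y hyΓ hyg
  have := hΓ.minimal _ Set.sdiff_subset hgen
  rw [← this] at hg
  exact hg.2 rfl

/-- Dickson's lemma: by `eq_of_le` the exponents of generators of one t-degree form an antichain in
ℕ^n. -/
theorem IsMinimalGenerators.finite_tDeg_eq (hΓ : IsMinimalGenerators Γ) (q : ℕ) :
    {g ∈ Γ | g.tDeg = q}.Finite := by
  have hinj : Set.InjOn (fun g : SymbolicMonomial I => g.1.1) {g ∈ Γ | g.tDeg = q} :=
    fun g hg h hh e => Subtype.ext (Prod.ext e (hg.2.trans hh.2.symm))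
  refine Set.Finite.of_finite_image ?_ hinj
  refine IsAntichain.finite_of_partiallyWellOrderedOn (r := (· ≤ ·)) ?_ 
    (Set.isPWO_of_wellQuasiOrderedLE _)
  rintro - ⟨h, hh, rfl⟩ - ⟨g, hg, rfl⟩ hne hle
  exact hne (hΓ.eq_of_le hg.1 (hh.2.trans hg.2.symm) hle)

theorem IsMinimalGenerators.finite_tDeg_le (hΓ : IsMinimalGenerators Γ) (k : ℕ) :
    {g ∈ Γ | g.tDeg ≤ k}.Finite := by
  refine ((Set.finite_Iic k).biUnion fun q _ => hΓ.finite_tDeg_eq q).subset ?_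
  rintro g ⟨hg, hk⟩
  simp only [Set.mem_iUnion]
  exact ⟨g.tDeg, hk, hg, rfl⟩

/-- As every q_s is positive, an admissible c uses only generators with q_s ≤ k. Finitely many such
exist, so their degrees have a bound D; then c_s deg(u_s) ≤ c_s q_s D, with total at most kD. -/
theorem IsMinimalGenerators.bddAbove_dValues (hΓ : IsMinimalGenerators Γ) (k : ℕ) :
    BddAbove (dValues Γ k) := by
  obtain ⟨D, hD⟩ := ((hΓ.finite_tDeg_le k).image SymbolicMonomial.xDeg).bddAbove
  refine ⟨k * D, ?_⟩
  rintro - ⟨c, hc, rfl⟩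
  refine le_trans ?_ (Nat.mul_le_mul_right D hc)
  rw [Finsupp.sum, Finsupp.sum, Finset.sum_mul]
  refine Finset.sum_le_sum fun g hg => ?_
  have hpos := hΓ.pos g.1 g.2
  have hcg : 0 < c g := Nat.pos_of_ne_zero (Finsupp.mem_support_iff.1 hg)
  have hle : c g * g.1.tDeg ≤ k :=
    (Finset.single_le_sum (f := fun g => c g * g.1.tDeg) (fun _ _ => Nat.zero_le _) hg).trans hc
  have hgD : g.1.xDeg ≤ D := hD ⟨g.1, ⟨g.2, (Nat.le_mul_of_pos_left _ hcg).trans hle⟩, rfl⟩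
  exact Nat.mul_le_mul (Nat.le_mul_of_pos_right _ hpos) hgD

/-- The family c = 0 gives a value and the values are bounded, so `sSup` is attained and is not the
default value for unbounded sets. -/
theorem IsMinimalGenerators.isGreatest_dMax (hΓ : IsMinimalGenerators Γ) (k : ℕ) :
    IsGreatest (dValues Γ k) (dMax Γ k) :=
  ⟨Nat.sSup_mem ⟨0, 0, by simp, by simp⟩ (hΓ.bddAbove_dValues k),
    fun _ hz => le_csSup (hΓ.bddAbove_dValues k) hz⟩

end ReesMonomials

/-! ### Homogeneous vectors -/

theorem LinearMap.apply_eq_sum_single {R M : Type*} [CommSemiring R] [AddCommMonoid M] [Module R M]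
    {r : ℕ} (f : (Fin r → R) →ₗ[R] M) (v : Fin r → R) :
    f v = ∑ l, v l • f (Pi.single l 1) := by
  rw [f.pi_apply_eq_sum_univ]
  refine Finset.sum_congr rfl fun l _ => ?_
  congr 2
  ext j
  simp [Pi.single_apply, eq_comm]

/-- A linear map on a free module can be prescribed on the basis. -/
theorem exists_linearMap_single {R M : Type*} [CommSemiring R] [AddCommMonoid M] [Module R M]
    {r : ℕ} (P : Fin r → M → Prop) (h : ∀ l, ∃ y, P l y) :
    ∃ f : (Fin r → R) →ₗ[R] M, ∀ l, P l (f (Pi.single l 1)) := by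
  choose y hy using h
  refine ⟨(Pi.basisFun R (Fin r)).constr R y, fun l => ?_⟩
  rw [← Pi.basisFun_apply, Module.Basis.constr_basis]
  exact hy l

section HomogeneousVectors

variable {σ K G : Type*} [Field K] [AddCommGroup G] {w : σ → G}

theorem weightedHomogeneousComponent_mul_of_isWeightedHomogeneous {p q : MvPolynomial σ K} {a : G}
    (hq : IsWeightedHomogeneous w q a) (g : G) :
    weightedHomogeneousComponent w g (p * q) = weightedHomogeneousComponent w (g - a) p * q := by
  classical
  induction p using MvPolynomial.induction_on' with
  | monomial u r =>
    have hu : IsWeightedHomogeneous w (monomial u r) (Finsupp.weight w u) :=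
      isWeightedHomogeneous_monomial w u r rfl
    by_cases h : Finsupp.weight w u = g - a
    · have h1 : IsWeightedHomogeneous w (monomial u r * q) g := by
        have := hu.mul hq
        rwa [h, sub_add_cancel] at this
      rw [h1.weightedHomogeneousComponent_same, ← h, hu.weightedHomogeneousComponent_same]
    · rw [hu.weightedHomogeneousComponent_ne _ (Ne.symm h), zero_mul,
        (hu.mul hq).weightedHomogeneousComponent_ne]
      exact fun h' => h (eq_sub_of_add_eq h'.symm)
  | add p₁ p₂ h₁ h₂ => rw [add_mul, map_add, map_add, h₁, h₂, add_mul]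

/-- The vector `v` is homogeneous of degree `g` in `⨁_j R(-s j)`. -/
def IsHomogeneousVector (w : σ → G) {r : ℕ} (s : Fin r → G) (v : Fin r → MvPolynomial σ K)
    (g : G) : Prop :=
  ∀ j, IsWeightedHomogeneous w (v j) (g - s j)

/-- The component of degree `g` of a vector in `⨁_j R(-s j)`. -/
def vectorComponent (w : σ → G) {r : ℕ} (s : Fin r → G) (g : G) (v : Fin r → MvPolynomial σ K) :
    Fin r → MvPolynomial σ K :=
  fun j => weightedHomogeneousComponent w (g - s j) (v j)

theorem isHomogeneousVector_vectorComponent {r : ℕ} (s : Fin r → G) (g : G)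
    (v : Fin r → MvPolynomial σ K) : IsHomogeneousVector w s (vectorComponent w s g v) g :=
  fun _ => weightedHomogeneousComponent_isWeightedHomogeneous _ _

theorem IsHomogeneousVector.smul {r : ℕ} {s : Fin r → G} {v : Fin r → MvPolynomial σ K} {g a : G}
    (hv : IsHomogeneousVector w s v g) {p : MvPolynomial σ K} (hp : IsWeightedHomogeneous w p a) :
    IsHomogeneousVector w s (p • v) (a + g) := fun j => by
  rw [Pi.smul_apply, smul_eq_mul, add_sub_assoc]
  exact hp.mul (hv j)

theorem IsHomogeneousVector.sum {r : ℕ} {s : Fin r → G} {ι : Type*} {t : Finset ι}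
    {v : ι → Fin r → MvPolynomial σ K} {g : G}
    (hv : ∀ i ∈ t, IsHomogeneousVector w s (v i) g) :
    IsHomogeneousVector w s (∑ i ∈ t, v i) g := fun j => by
  rw [Finset.sum_apply]
  exact IsWeightedHomogeneous.sum t _ _ fun i hi => hv i hi j

end HomogeneousVectors

/-! ### Homogeneous components and minimality in graded free resolutions -/

namespace GradedFreeResolution

variable {σ K G : Type*} [Field K] [AddCommGroup G] {w : σ → G}
  {M : Type*} [AddCommGroup M] [Module (MvPolynomial σ K) M] {ℳ : G → AddSubgroup M}
  (F : GradedFreeResolution K w ℳ)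

theorem d_vectorComponent (i : ℕ) (g : G) (v : Fin (F.rank (i + 1)) → MvPolynomial σ K) :
    F.d i (vectorComponent w (F.shift (i + 1)) g v) =
      vectorComponent w (F.shift i) g (F.d i v) := by
  rw [(F.d i).apply_eq_sum_single, (F.d i).apply_eq_sum_single v]
  ext1 j
  rw [vectorComponent]
  simp only [Finset.sum_apply, Pi.smul_apply, smul_eq_mul, map_sum]
  refine Finset.sum_congr rfl fun l _ => ?_
  rw [weightedHomogeneousComponent_mul_of_isWeightedHomogeneous (F.d_homogeneous i l j),
    sub_sub_sub_cancel_right]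
  rfl

/-- The differential commutes with taking components, so the degree g component of any preimage is
again a preimage. -/
theorem exists_isHomogeneousVector_d_eq {i : ℕ} {g : G} {z : Fin (F.rank i) → MvPolynomial σ K}
    (hz : IsHomogeneousVector w (F.shift i) z g) (h : ∃ y, F.d i y = z) :
    ∃ y, IsHomogeneousVector w (F.shift (i + 1)) y g ∧ F.d i y = z := by
  obtain ⟨y, hy⟩ := h
  refine ⟨_, isHomogeneousVector_vectorComponent (F.shift (i + 1)) g y, ?_⟩
  rw [F.d_vectorComponent, hy]
  exact funext fun j => (hz j).weightedHomogeneousComponent_same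

theorem d_comp_d (i : ℕ) : F.d i ∘ₗ F.d (i + 1) = 0 := (F.exact_succ i).linearMap_comp_eq_zero

theorem aug_comp_d : F.aug ∘ₗ F.d 0 = 0 := F.exact_zero.linearMap_comp_eq_zero

variable {F}

theorem IsMinimal.constantCoeff_d (hF : F.IsMinimal) (i : ℕ)
    (v : Fin (F.rank (i + 1)) → MvPolynomial σ K) (j : Fin (F.rank i)) :
    constantCoeff (F.d i v j) = 0 := by
  rw [(F.d i).apply_eq_sum_single]
  simp [Finset.sum_apply, hF i _ j]

/-- A basis vector in the kernel would be a boundary, but boundaries in a minimal resolution have no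
constant terms. -/
theorem IsMinimal.aug_single_ne_zero (hF : F.IsMinimal) (l : Fin (F.rank 0)) :
    F.aug (Pi.single l 1) ≠ 0 := fun h => by
  obtain ⟨v, hv⟩ := (F.exact_zero _).1 h
  have := hF.constantCoeff_d 0 v l
  rw [hv] at this
  simp at this

theorem IsMinimal.d_single_ne_zero (hF : F.IsMinimal) (i : ℕ) (l : Fin (F.rank (i + 1))) :
    F.d i (Pi.single l 1) ≠ 0 := fun h => by
  obtain ⟨v, hv⟩ := (F.exact_succ i _).1 h
  have := hF.constantCoeff_d (i + 1) v l
  rw [hv] at this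
  simp at this

/-- If a nonzero module element and all monomials have degrees on which `δ` is nonnegative, then so
do the basis vectors of a minimal resolution. -/
theorem IsMinimal.shift_nonneg (hF : F.IsMinimal) (δ : G →+ ℤ) (hw : ∀ u, 0 ≤ δ (w u))
    (hM : ∀ g, ∀ m ∈ ℳ g, m ≠ 0 → 0 ≤ δ g) (i : ℕ) (l : Fin (F.rank i)) :
    0 ≤ δ (F.shift i l) := by
  induction i with
  | zero => exact hM _ _ (F.aug_homogeneous l) (hF.aug_single_ne_zero l)
  | succ i ih =>
    -- A monomial of a nonzero entry of the differential has weight equal to the difference of the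
    -- two shifts, and δ is nonnegative on that weight.
    obtain ⟨j, hj⟩ := Function.ne_iff.1 (hF.d_single_ne_zero i l)
    obtain ⟨u, hu⟩ := MvPolynomial.ne_zero_iff.1 hj
    have h := F.d_homogeneous i l j hu
    have h0 : 0 ≤ δ (Finsupp.weight w u) := by
      rw [Finsupp.weight_apply, Finsupp.sum, map_sum]
      refine Finset.sum_nonneg fun s _ => ?_
      rw [map_nsmul]
      exact nsmul_nonneg (hw s) _
    rw [h, map_sub] at h0
    linarith [ih j]

/-- The finite range loses nothing, since the ranks vanish beyond `length`. -/
theorem reg_le_iff {δ : G → ℤ} {b : WithBot ℤ} :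
    F.reg δ ≤ b ↔ ∀ i (j : Fin (F.rank i)), ((δ (F.shift i j) - (i : ℤ) : ℤ) : WithBot ℤ) ≤ b := by
  refine ⟨fun h i j => ?_, fun h => Finset.sup_le fun i _ => Finset.sup_le fun j _ => h i j⟩
  have hi : i ∈ Finset.range (F.length + 1) := by
    rw [Finset.mem_range]
    by_contra hlt
    have := F.rank_eq_zero i (by omega)
    exact absurd j.2 (by omega)
  exact (Finset.le_sup (f := fun j : Fin (F.rank i) =>
    ((δ (F.shift i j) - (i : ℤ) : ℤ) : WithBot ℤ)) (Finset.mem_univ j)).trans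
    ((Finset.le_sup (f := fun i => Finset.univ.sup fun j : Fin (F.rank i) =>
      ((δ (F.shift i j) - (i : ℤ) : ℤ) : WithBot ℤ)) hi).trans h)

end GradedFreeResolution

/-! ### Polynomials in two sets of variables as a module over those in the first set -/

section SumAlgebra

variable {σ τ K : Type*} [Field K]

/-- `K[x, y]` as a `K[x]`-algebra. -/
@[reducible]
def algebraSumInl (σ τ K : Type*) [Field K] :
    Algebra (MvPolynomial σ K) (MvPolynomial (σ ⊕ τ) K) :=
  (rename Sum.inl : MvPolynomial σ K →ₐ[K] MvPolynomial (σ ⊕ τ) K).toRingHom.toAlgebra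

attribute [local instance] algebraSumInl

theorem smul_eq_rename_mul (p : MvPolynomial σ K) (q : MvPolynomial (σ ⊕ τ) K) :
    p • q = rename Sum.inl p * q := rfl

/-- `K[x, y] = K[x][y]` as a `K[x]`-module. -/
def sumLinearEquiv (σ τ K : Type*) [Field K] :
    MvPolynomial (σ ⊕ τ) K ≃ₗ[MvPolynomial σ K] MvPolynomial τ (MvPolynomial σ K) :=
  let e : MvPolynomial (σ ⊕ τ) K ≃ₐ[K] MvPolynomial τ (MvPolynomial σ K) :=
    (renameEquiv K (Equiv.sumComm σ τ)).trans (sumAlgEquiv K τ σ)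
  { e with
    map_smul' := fun p q => by
      have h : ∀ p : MvPolynomial σ K, e (rename Sum.inl p) = C p := by
        intro p
        induction p using MvPolynomial.induction_on with
        | C a => simp [e]
        | add p q hp hq => simp only [map_add, hp, hq]
        | mul_X p i hp => rw [map_mul, map_mul, hp, C_mul]; simp [e]
      change e (p • q) = p • e q
      rw [smul_eq_rename_mul, map_mul, h, smul_eq_C_mul] }

/-- The monomials in y form a basis. This freeness makes F a complex of projectives over K[x]. -/
instance free_sum : Module.Free (MvPolynomial σ K) (MvPolynomial (σ ⊕ τ) K) :=
  Module.Free.of_equiv (sumLinearEquiv σ τ K).symm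

/-- A vector all of whose monomials involve some `x_i` lies in `(x)` times the free module. -/
theorem mem_smul_top_of_forall_exists_inl_ne_zero {r : ℕ} (v : Fin r → MvPolynomial (σ ⊕ τ) K)
    (h : ∀ j, ∀ u ∈ (v j).support, ∃ i, u (Sum.inl i) ≠ 0) :
    v ∈ RingHom.ker (constantCoeff : MvPolynomial σ K →+* K) •
      (⊤ : Submodule (MvPolynomial σ K) (Fin r → MvPolynomial (σ ⊕ τ) K)) := by
  classical
  rw [← Finset.univ_sum_single v]
  refine Submodule.sum_mem _ fun j _ => ?_
  rw [(v j).as_sum, ← LinearMap.coe_single (MvPolynomial σ K), map_sum]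
  refine Submodule.sum_mem _ fun u hu => ?_
  obtain ⟨i, hi⟩ := h j u hu
  have : monomial u (coeff u (v j)) = (X i : MvPolynomial σ K) •
      monomial (u - Finsupp.single (Sum.inl i) 1) (coeff u (v j)) := by
    rw [smul_eq_rename_mul, rename_X, X, monomial_mul, one_mul,
      add_tsub_cancel_of_le (Finsupp.single_le_iff.2 (Nat.one_le_iff_ne_zero.2 hi))]
  rw [this, LinearMap.map_smul]
  exact Submodule.smul_mem_smul (by simp [RingHom.mem_ker]) trivial

end SumAlgebra

attribute [local instance] algebraSumInl

theorem mem_smul_top_of_forall_constantCoeff {σ K : Type*} [Field K] {r : ℕ}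
    (v : Fin r → MvPolynomial σ K) (h : ∀ j, constantCoeff (v j) = 0) :
    v ∈ RingHom.ker (constantCoeff : MvPolynomial σ K →+* K) •
      (⊤ : Submodule (MvPolynomial σ K) (Fin r → MvPolynomial σ K)) := by
  rw [show v = ∑ j, v j • Pi.single j 1 by simpa using LinearMap.id.apply_eq_sum_single v]
  exact Submodule.sum_mem _ fun j _ => Submodule.smul_mem_smul (h j) trivial

theorem constantCoeff_eq_zero_of_mem_smul_top {σ K : Type*} [Field K] {r : ℕ}
    {v : Fin r → MvPolynomial σ K}
    (h : v ∈ RingHom.ker (constantCoeff : MvPolynomial σ K →+* K) •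
      (⊤ : Submodule (MvPolynomial σ K) (Fin r → MvPolynomial σ K))) (j : Fin r) :
    constantCoeff (v j) = 0 := by
  induction h using Submodule.smul_induction_on' with
  | smul p hp u _ => rw [Pi.smul_apply, smul_eq_mul, map_mul, hp, zero_mul]
  | add u _ v _ hu hv => rw [Pi.add_apply, map_add, hu, hv, add_zero]

/-! ### The symbolic Rees algebra as a graded `T`-module -/

namespace ReesModule

variable {K : Type*} [Field K] {n : ℕ} {I : Ideal (MvPolynomial (Fin n) K)}
  {Γ : Set (SymbolicMonomial I)}

/-- An element of the symbolic Rees algebra as a polynomial in `t`. -/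
def val (f : ReesModule Γ) : Polynomial (MvPolynomial (Fin n) K) :=
  (show symbolicReesAlgebra I from f).1

theorem val_injective : Function.Injective (val : ReesModule Γ → _) := Subtype.val_injective

theorem val_add (f g : ReesModule Γ) : (f + g).val = f.val + g.val := rfl

theorem val_smul (p : MvPolynomial (Fin n ⊕ Γ) K) (f : ReesModule Γ) :
    (p • f).val = (reesMap Γ p).1 * f.val := rfl

instance : Module (MvPolynomial (Fin n) K) (ReesModule Γ) :=
  Module.compHom _ (algebraMap (MvPolynomial (Fin n) K) (MvPolynomial (Fin n ⊕ Γ) K))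

instance : IsScalarTower (MvPolynomial (Fin n) K) (MvPolynomial (Fin n ⊕ Γ) K) (ReesModule Γ) :=
  IsScalarTower.of_algebraMap_smul fun _ _ => rfl

theorem reesMap_rename_inl (p : MvPolynomial (Fin n) K) :
    (reesMap Γ (rename Sum.inl p)).1 = Polynomial.C p := by
  induction p using MvPolynomial.induction_on with
  | C a =>
    rw [rename_C, ← algebraMap_eq, AlgHom.commutes]
    rfl
  | add p q hp hq => rw [map_add, map_add, Subalgebra.coe_add, hp, hq, Polynomial.C_add]
  | mul_X p i hp =>
    rw [map_mul, map_mul, Subalgebra.coe_mul, hp, rename_X, Polynomial.C_mul]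
    simp [reesMap, xRees]

theorem val_smul_left (p : MvPolynomial (Fin n) K) (f : ReesModule Γ) :
    (p • f).val = Polynomial.C p * f.val := by
  rw [← reesMap_rename_inl (Γ := Γ)]
  rfl

/-- The projection of the symbolic Rees algebra onto its `k`-th component. -/
def proj (Γ : Set (SymbolicMonomial I)) (k : ℕ) :
    ReesModule Γ →ₗ[MvPolynomial (Fin n) K] symbolicPower I k where
  toFun f := ⟨f.val.coeff k, f.2 k⟩
  map_add' f g := Subtype.ext (Polynomial.coeff_add f.val g.val k)
  map_smul' p f := Subtype.ext <| by
    change (p • f).val.coeff k = p * f.val.coeff k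
    rw [val_smul_left, Polynomial.coeff_C_mul]

/-- The element `z t^k` of the symbolic Rees algebra. -/
def ofComponent (Γ : Set (SymbolicMonomial I)) (k : ℕ) (z : symbolicPower I k) : ReesModule Γ :=
  (⟨Polynomial.monomial k z.1, fun q => by
    rw [Polynomial.coeff_monomial]
    split_ifs with h
    · exact h ▸ z.2
    · exact Ideal.zero_mem _⟩ : symbolicReesAlgebra I)

theorem val_ofComponent (k : ℕ) (z : symbolicPower I k) :
    (ofComponent Γ k z).val = Polynomial.monomial k z.1 := rfl

/-- The inclusion of the `k`-th component into the symbolic Rees algebra. -/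
def incl (Γ : Set (SymbolicMonomial I)) (k : ℕ) :
    symbolicPower I k →ₗ[MvPolynomial (Fin n) K] ReesModule Γ where
  toFun := ofComponent Γ k
  map_add' y z := val_injective <| by
    rw [val_add, val_ofComponent, val_ofComponent, val_ofComponent, Submodule.coe_add, map_add]
  map_smul' p z := val_injective <| by
    rw [RingHom.id_apply, val_smul_left, val_ofComponent, val_ofComponent,
      Polynomial.C_mul_monomial]
    rfl

theorem proj_comp_incl (k : ℕ) : proj Γ k ∘ₗ incl Γ k = LinearMap.id :=
  LinearMap.ext fun z => Subtype.ext (Polynomial.coeff_monomial_same k z.1)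

theorem incl_mem_reesBigrading {k : ℕ} {a : ℤ} {z : symbolicPower I k}
    (hz : z ∈ idealGrading (symbolicPower I k) a) : incl Γ k z ∈ reesBigrading Γ (a, (k : ℤ)) := by
  intro q e h
  change ((Polynomial.monomial k z.1).coeff q).coeff e ≠ 0 at h
  rw [Polynomial.coeff_monomial] at h
  split_ifs at h with hq
  · rw [hz e h, hq]
  · exact absurd rfl h

theorem mem_reesBigrading {f : ReesModule Γ} {g : ℤ × ℤ} :
    f ∈ reesBigrading Γ g ↔
      ∀ (k : ℕ) (e : Fin n →₀ ℕ), (f.val.coeff k).coeff e ≠ 0 → ((e.degree : ℤ), (k : ℤ)) = g :=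
  Iff.rfl

theorem monomial_smul_mem {s : ℤ × ℤ} {m : ReesModule Γ} (hm : m ∈ reesBigrading Γ s)
    (u : Fin n ⊕ Γ →₀ ℕ) (r : K) :
    monomial u r • m ∈ reesBigrading Γ (Finsupp.weight (reesBideg Γ) u + s) := by
  rw [mem_reesBigrading] at hm ⊢
  intro k e h
  rw [val_smul, reesMap_monomial] at h
  by_cases hk : (reesExponent Γ u).2 ≤ k
  · obtain ⟨k, rfl⟩ := Nat.exists_eq_add_of_le' hk
    rw [Polynomial.coeff_monomial_mul, coeff_monomial_mul'] at h
    split_ifs at h with he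
    · rw [← hm _ _ (right_ne_zero_of_mul h), weight_reesBideg, Prod.mk_add_mk, ← Nat.cast_add,
        ← map_add, add_tsub_cancel_of_le he, ← Nat.cast_add, add_comm k]
    · exact absurd rfl h
  · rw [← Polynomial.C_mul_X_pow_eq_monomial, mul_assoc, Polynomial.coeff_C_mul,
      Polynomial.coeff_X_pow_mul', if_neg hk] at h
    simp at h

theorem smul_mem {s a : ℤ × ℤ} {m : ReesModule Γ} (hm : m ∈ reesBigrading Γ s)
    {p : MvPolynomial (Fin n ⊕ Γ) K} (hp : IsWeightedHomogeneous (reesBideg Γ) p a) :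
    p • m ∈ reesBigrading Γ (a + s) := by
  rw [p.as_sum, Finset.sum_smul]
  refine AddSubgroup.sum_mem _ fun u hu => ?_
  rw [← hp (mem_support_iff.1 hu)]
  exact monomial_smul_mem hm u _

/-- Homogeneous parts are compared one coefficient at a time, which avoids decomposing the module
into its bigraded pieces. -/
theorem coeff_smul_eq_coeff_component_smul {s : ℤ × ℤ} {m : ReesModule Γ}
    (hm : m ∈ reesBigrading Γ s) (p : MvPolynomial (Fin n ⊕ Γ) K) (k : ℕ) (e : Fin n →₀ ℕ) :
    ((p • m).val.coeff k).coeff e =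
      ((weightedHomogeneousComponent (reesBideg Γ) (((e.degree : ℤ), (k : ℤ)) - s) p •
        m).val.coeff k).coeff e := by
  induction p using MvPolynomial.induction_on' with
  | monomial u r =>
    have hu : IsWeightedHomogeneous (reesBideg Γ) (monomial u r) (Finsupp.weight (reesBideg Γ) u) :=
      isWeightedHomogeneous_monomial _ u r rfl
    by_cases h : Finsupp.weight (reesBideg Γ) u = ((e.degree : ℤ), (k : ℤ)) - s
    · rw [← h, hu.weightedHomogeneousComponent_same]
    · rw [hu.weightedHomogeneousComponent_ne _ (Ne.symm h), zero_smul]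
      by_contra h0
      exact h (eq_sub_of_add_eq (mem_reesBigrading.1 (monomial_smul_mem hm u r) k e h0).symm)
  | add p q hp hq =>
    rw [map_add, add_smul, add_smul, val_add, val_add, Polynomial.coeff_add, Polynomial.coeff_add,
      coeff_add, coeff_add, hp, hq]

end ReesModule

/-! ### Lifting the inclusion of I^(k) to a chain map of resolutions -/

section Lift

variable {K : Type*} [Field K] {n : ℕ} {I : Ideal (MvPolynomial (Fin n) K)}
  {Γ : Set (SymbolicMonomial I)} (F : GradedFreeResolution K (reesBideg Γ) (reesBigrading Γ))

open ReesModule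

theorem coeff_aug_eq_coeff_aug_vectorComponent (v : Fin (F.rank 0) → MvPolynomial (Fin n ⊕ Γ) K)
    (k : ℕ) (e : Fin n →₀ ℕ) :
    ((F.aug v).val.coeff k).coeff e =
      ((F.aug (vectorComponent (reesBideg Γ) (F.shift 0) ((e.degree : ℤ), (k : ℤ)) v)).val.coeff
        k).coeff e := by
  let c : ReesModule Γ →+ K :=
    { toFun := fun f => (f.val.coeff k).coeff e
      map_zero' := rfl
      map_add' := fun f g => by rw [val_add, Polynomial.coeff_add, coeff_add] }
  change c _ = c _
  rw [F.aug.apply_eq_sum_single, F.aug.apply_eq_sum_single (vectorComponent _ _ _ _), map_sum,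
    map_sum]
  exact Finset.sum_congr rfl fun l _ =>
    coeff_smul_eq_coeff_component_smul (F.aug_homogeneous l) (v l) k e

/-- Cut any preimage down to its component of degree `g`: coefficients in bidegree `g` are
unchanged, and all others vanish on both sides. -/
theorem exists_isHomogeneousVector_aug_eq {g : ℤ × ℤ} {z : ReesModule Γ}
    (hz : z ∈ reesBigrading Γ g) :
    ∃ y, IsHomogeneousVector (reesBideg Γ) (F.shift 0) y g ∧ F.aug y = z := by
  obtain ⟨y, rfl⟩ := F.aug_surjective z
  set y' := vectorComponent (reesBideg Γ) (F.shift 0) g y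
  have hy' : IsHomogeneousVector (reesBideg Γ) (F.shift 0) y' g :=
    isHomogeneousVector_vectorComponent _ g y
  refine ⟨y', hy', val_injective (Polynomial.ext fun k => MvPolynomial.ext _ _ fun e => ?_)⟩
  have hmem : F.aug y' ∈ reesBigrading Γ g := by
    rw [F.aug.apply_eq_sum_single]
    refine AddSubgroup.sum_mem _ fun l _ => ?_
    have := smul_mem (F.aug_homogeneous l) (hy' l)
    rwa [sub_add_cancel] at this
  by_cases hg : ((e.degree : ℤ), (k : ℤ)) = g
  · rw [coeff_aug_eq_coeff_aug_vectorComponent F y, hg]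
  · rw [not_not.1 (mt (mem_reesBigrading.1 hmem k e) hg),
      not_not.1 (mt (mem_reesBigrading.1 hz k e) hg)]

theorem weight_mapDomain_inl (u : Fin n →₀ ℕ) :
    Finsupp.weight (reesBideg Γ) (u.mapDomain Sum.inl) =
      (Finsupp.weight (fun _ : Fin n => (1 : ℤ)) u, 0) := by
  induction u using Finsupp.induction_linear with
  | zero => simp; rfl
  | add u v hu hv => rw [Finsupp.mapDomain_add, map_add, map_add, hu, hv, Prod.mk_add_mk, add_zero]
  | single i m =>
    simp [Finsupp.mapDomain_single, Finsupp.weight_apply, Finsupp.sum_single_index, reesBideg,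
      -nsmul_eq_mul]

theorem isWeightedHomogeneous_rename_inl {p : MvPolynomial (Fin n) K} {a : ℤ}
    (hp : IsWeightedHomogeneous (fun _ => (1 : ℤ)) p a) :
    IsWeightedHomogeneous (reesBideg Γ) (rename Sum.inl p : MvPolynomial (Fin n ⊕ Γ) K) (a, 0) := by
  rw [p.as_sum, map_sum]
  refine IsWeightedHomogeneous.sum _ _ _ fun u hu => ?_
  rw [rename_monomial]
  refine isWeightedHomogeneous_monomial _ _ _ ?_
  rw [← hp (mem_support_iff.1 hu)]
  exact weight_mapDomain_inl u

variable {k : ℕ} (H : GradedFreeResolution K (fun _ : Fin n => (1 : ℤ))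
  (idealGrading (symbolicPower I k)))

/-- The inclusion of `I^(k)` lifts to a bihomogeneous chain map of resolutions. -/
theorem exists_homogeneous_chainMap :
    ∃ φ : ∀ i, (Fin (H.rank i) → MvPolynomial (Fin n) K) →ₗ[MvPolynomial (Fin n) K]
        (Fin (F.rank i) → MvPolynomial (Fin n ⊕ Γ) K),
      (∀ i l, IsHomogeneousVector (reesBideg Γ) (F.shift i) (φ i (Pi.single l 1))
        (H.shift i l, (k : ℤ))) ∧
      (∀ x, F.aug (φ 0 x) = incl Γ k (H.aug x)) ∧
      ∀ i x, F.d i (φ (i + 1) x) = φ i (H.d i x) := by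
  obtain ⟨φ₀, hφ₀⟩ := exists_linearMap_single (R := MvPolynomial (Fin n) K)
    (fun (l : Fin (H.rank 0)) y => IsHomogeneousVector (reesBideg Γ) (F.shift 0) y
      (H.shift 0 l, (k : ℤ)) ∧ F.aug y = incl Γ k (H.aug (Pi.single l 1)))
    fun l => exists_isHomogeneousVector_aug_eq F (incl_mem_reesBigrading (H.aug_homogeneous l))
  have haug : ∀ x, F.aug (φ₀ x) = incl Γ k (H.aug x) := by
    have : F.aug.restrictScalars (MvPolynomial (Fin n) K) ∘ₗ φ₀ = incl Γ k ∘ₗ H.aug :=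
      (Pi.basisFun _ _).ext fun l => by
        rw [Pi.basisFun_apply]
        exact (hφ₀ l).2
    exact LinearMap.congr_fun this
  obtain ⟨φ, hφ, hR⟩ := exists_dependent_seq
    (X := fun i => (Fin (H.rank i) → MvPolynomial (Fin n) K) →ₗ[MvPolynomial (Fin n) K]
      (Fin (F.rank i) → MvPolynomial (Fin n ⊕ Γ) K))
    (fun i f => (∀ l, IsHomogeneousVector (reesBideg Γ) (F.shift i) (f (Pi.single l 1))
        (H.shift i l, (k : ℤ))) ∧ (∀ x, ∃ y, F.d i y = f (H.d i x)) ∧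
        ((h : i = 0) → f = h ▸ φ₀))
    (fun i f g => ∀ x, F.d i (g x) = f (H.d i x))
    ⟨φ₀, fun l => (hφ₀ l).1, fun x => (F.exact_zero _).1 (by
      rw [haug, H.exact_zero.apply_apply_eq_zero, map_zero]), fun _ => rfl⟩ (by
      rintro i f ⟨hf, hd, -⟩
      -- Entries of `H.d` have bidegree (·, 0) in T, so f(d e_l) keeps t-degree k and has a
      -- homogeneous preimage.
      obtain ⟨g, hg⟩ := exists_linearMap_single (R := MvPolynomial (Fin n) K)
        (fun (l : Fin (H.rank (i + 1))) y => IsHomogeneousVector (reesBideg Γ) (F.shift (i + 1)) y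
          (H.shift (i + 1) l, (k : ℤ)) ∧ F.d i y = f (H.d i (Pi.single l 1)))
        fun l => F.exists_isHomogeneousVector_d_eq (by
          rw [f.apply_eq_sum_single]
          refine IsHomogeneousVector.sum fun j _ => ?_
          have := (hf j).smul (isWeightedHomogeneous_rename_inl (Γ := Γ) (H.d_homogeneous i l j))
          rwa [Prod.mk_add_mk, sub_add_cancel, zero_add] at this) (hd _)
      have hgf : ∀ x, F.d i (g x) = f (H.d i x) := by
        have : (F.d i).restrictScalars (MvPolynomial (Fin n) K) ∘ₗ g = f ∘ₗ H.d i :=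
          (Pi.basisFun _ _).ext fun l => by
            rw [Pi.basisFun_apply]
            exact (hg l).2
        exact LinearMap.congr_fun this
      refine ⟨g, ⟨fun l => (hg l).1, fun x => (F.exact_succ i _).1 ?_, fun h => by omega⟩, hgf⟩
      rw [hgf, (H.exact_succ i).apply_apply_eq_zero, map_zero])
  refine ⟨φ, fun i => (hφ i).1, ?_, hR⟩
  rw [(hφ 0).2.2 rfl]
  exact haug

/-- Each basis vector of the minimal resolution of `I^(k)` has the degree of some `y^c` times a
basis vector of the resolution of the symbolic Rees algebra. -/
theorem exists_shift_eq (hH : H.IsMinimal) (i : ℕ) (l : Fin (H.rank i)) :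
    ∃ (j : Fin (F.rank i)) (u : Fin n ⊕ Γ →₀ ℕ), (∀ s, u (Sum.inl s) = 0) ∧
      F.shift i j + Finsupp.weight (reesBideg Γ) u = (H.shift i l, (k : ℤ)) := by
  obtain ⟨φ, hhom, haug, hd⟩ := exists_homogeneous_chainMap F H
  by_contra! hne
  -- If no x-free monomial occurred in φ(e_l), then φ(e_l) would lie in (x)F_i; injectivity modulo
  -- (x) would then put e_l itself in (x)H_i.
  have hmem : φ i (Pi.single l 1) ∈ RingHom.ker (constantCoeff : MvPolynomial (Fin n) K →+* K) •
      (⊤ : Submodule (MvPolynomial (Fin n) K) (Fin (F.rank i) → MvPolynomial (Fin n ⊕ Γ) K)) := by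
    refine mem_smul_top_of_forall_exists_inl_ne_zero _ fun j u hu => ?_
    by_contra! h0
    refine hne j u h0 ?_
    rw [hhom i l j (mem_support_iff.1 hu), add_sub_cancel]
  have := mem_smul_top_of_chainMap_mem (dA := H.d) (augA := H.aug)
    (dB := fun i => (F.d i).restrictScalars (MvPolynomial (Fin n) K))
    (augB := F.aug.restrictScalars (MvPolynomial (Fin n) K)) H.aug_surjective H.exact_zero
    H.exact_succ (fun i x => mem_smul_top_of_forall_constantCoeff _ (hH.constantCoeff_d i x))
    (LinearMap.ext fun x => LinearMap.congr_fun F.aug_comp_d x)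
    (fun i => LinearMap.ext fun x => LinearMap.congr_fun (F.d_comp_d i) x) (proj Γ k) φ
    (LinearMap.ext fun x => by
      change proj Γ k (F.aug (φ 0 x)) = _
      rw [haug]
      exact LinearMap.congr_fun (proj_comp_incl k) _)
    (fun i => LinearMap.ext (hd i)) i (Pi.single l 1) hmem
  have h1 := constantCoeff_eq_zero_of_mem_smul_top this l
  simp at h1

end Lift

/-! ### Bidegree bookkeeping and the final bound -/

theorem GradedFreeResolution.IsMinimal.shift_snd_nonneg {K : Type*} [Field K] {n : ℕ}
    {I : Ideal (MvPolynomial (Fin n) K)} {Γ : Set (SymbolicMonomial I)}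
    {F : GradedFreeResolution K (reesBideg Γ) (reesBigrading Γ)} (hF : F.IsMinimal) (i : ℕ)
    (j : Fin (F.rank i)) : 0 ≤ (F.shift i j).2 := by
  -- The t-degree is nonnegative on all variables of T and on all nonzero bihomogeneous elements of
  -- R_s(I).
  refine hF.shift_nonneg (AddMonoidHom.snd ℤ ℤ) ?_ ?_ i j
  · rintro (s | g)
    · exact le_rfl
    · exact Int.natCast_nonneg _
  · intro g m hm hne
    have : ∃ q e, (m.val.coeff q).coeff e ≠ 0 := by
      by_contra! h
      exact hne (ReesModule.val_injective
        (Polynomial.ext fun q => MvPolynomial.ext _ _ fun e => h q e))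
    obtain ⟨q, e, h⟩ := this
    rw [← ReesModule.mem_reesBigrading.1 hm q e h]
    exact Int.natCast_nonneg _

theorem weight_reesBideg_eq_sum {K : Type*} [Field K] {n : ℕ}
    {I : Ideal (MvPolynomial (Fin n) K)} {Γ : Set (SymbolicMonomial I)} {u : Fin n ⊕ Γ →₀ ℕ}
    (hu : ∀ s, u (Sum.inl s) = 0) :
    ∃ c : Γ →₀ ℕ, Finsupp.weight (reesBideg Γ) u =
      (((c.sum fun g m => m * g.1.xDeg : ℕ) : ℤ), ((c.sum fun g m => m * g.1.tDeg : ℕ) : ℤ)) := by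
  refine ⟨u.comapDomain Sum.inr Sum.inr_injective.injOn, ?_⟩
  have hu' : u = Finsupp.embDomain Function.Embedding.inr
      (u.comapDomain Sum.inr Sum.inr_injective.injOn) := by
    ext s
    rcases s with s | g
    · rw [hu, Finsupp.embDomain_of_notMem_range]
      simp
    · exact (Finsupp.embDomain_apply_self Function.Embedding.inr
        (u.comapDomain Sum.inr Sum.inr_injective.injOn) g).symm
  generalize Finsupp.comapDomain Sum.inr u _ = c at hu' ⊢
  rw [hu', Finsupp.weight_apply, Finsupp.sum_embDomain]
  ext <;> simp [Finsupp.sum, reesBideg, Prod.fst_sum, Prod.snd_sum]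

end

theorem theorem1p1 {K : Type*} [Field K] {n : ℕ} (I : Ideal (MvPolynomial (Fin n) K))
    (hI : IsMonomialIdeal I)
    (Γ : Set (SymbolicMonomial I)) (hΓ : IsMinimalGenerators Γ)
    (F : GradedFreeResolution K (reesBideg Γ) (reesBigrading Γ)) (hF : F.IsMinimal)
    (k : ℕ) (hk : 1 ≤ k) :
    IsGreatest (dValues Γ k) (dMax Γ k) ∧
      ∀ H : GradedFreeResolution K (fun _ : Fin n => (1 : ℤ))
          (idealGrading (symbolicPower I k)),
        H.IsMinimal →
          H.reg id ≤ F.reg Prod.fst + (((dMax Γ k : ℕ) : ℤ) : WithBot ℤ) := by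
  refine ⟨hΓ.isGreatest_dMax k, fun H hH => GradedFreeResolution.reg_le_iff.2 fun i l => ?_⟩
  obtain ⟨j, u, hu, heq⟩ := exists_shift_eq F H hH i l
  obtain ⟨c, hc⟩ := weight_reesBideg_eq_sum hu
  rw [hc, Prod.ext_iff] at heq
  obtain ⟨h1, h2⟩ := heq
  simp only [Prod.fst_add, Prod.snd_add] at h1 h2
  have hb := hF.shift_snd_nonneg i j
  -- Here b_ij + ∑ c_s q_s = k with b_ij ≥ 0, so c is admissible for d(I, k).
  have hd : (c.sum fun g m => m * g.1.xDeg) ≤ dMax Γ k :=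
    (hΓ.isGreatest_dMax k).2 ⟨c, by omega, rfl⟩
  refine le_trans ?_ (add_le_add_left (GradedFreeResolution.reg_le_iff.1 le_rfl i j) _)
  rw [← WithBot.coe_add, WithBot.coe_le_coe, id]
  omega
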